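/- Let $K$ be a $p$-adic field (a finite extension of some $\mathbb{Q}_\ell$) with ring of integers $\mathcal{O}_K$, uniformizer $p$ and residue field of cardinality $q$. Let $L$ be a reduced commutative $K$-algebra of dimension $2$ over $K$, let $\mathcal{O}_L$ be the integral closure of $\mathcal{O}_K$ in $L$, and let $\Delta\in\mathcal{O}_L$ be such that $\mathcal{O}_L=\mathcal{O}_K[\Delta]$. For $n\ge 0$ let $\mathcal{O}_n=\mathcal{O}_K[p^n\Delta]$ and $$\zeta_n(s)=\sum_{I\subseteq\mathcal{O}_n}\frac{1}{[\mathcal{O}_n:I]^{s}},$$ where the sum runs over all ideals $I$ of $\mathcal{O}_n$ of finite index. The case is called *ramified* (respectively *unramified*) if $L$ is a field and $p\mathcal{O}_L=(\pi\mathcal{O}_L)^2$ (respectively $p\mathcal{O}_L=\pi\mathcal{O}_L$) for a uniformizer $\pi$ of $\mathcal{O}_L$, and *split* if $L\cong K\times K$ as a $K$-algebra. Define polynomials by $$R_n(X)=\sum_{k=0}^{n}q^kX^{2k}\quad(n\ge 0),\qquad U_0(X)=S_0(X)=1,$$ $$U_n(X)=(1+X)R_{n-1}(X)+q^nX^{2n},\qquad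 S_n(X)=(1-X)R_{n-1}(X)+q^nX^{2n}\quad(n\ge 1).$$ Explicitly, for all $n\ge 0$, $$U_n(X)=\sum_{k=0}^{n-1}\left(q^kX^{2k}+q^kX^{2k+1}\right)+q^nX^{2n},\qquad S_n(X)=\sum_{k=0}^{n-1}\left(q^kX^{2k}-q^kX^{2k+1}\right)+q^nX^{2n}.$$ Then for every $n\ge 0$ and every complex $s$ with $\operatorname{Re}(s)>0$ the series $\zeta_n(s)$ converges absolutely, and - in the ramified case, $(1-q^{-s})\,\zeta_n(s)=R_n(q^{-s})$; - in the unramified case, $(1-q^{-2s})\,\zeta_n(s)=U_n(q^{-s})$; - in the split case, $(1-q^{-s})^2\,\zeta_n(s)=S_n(q^{-s})$. -/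

import Mathlib

open Polynomial
open scoped ValuativeRel

/-- The zeta function of a commutative ring `A` (used for orders): the sum of `[A : I]⁻ˢ` over all
ideals `I` of `A` of finite index. -/
noncomputable def idealZeta (A : Type*) [CommRing A] (s : ℂ) : ℂ :=
  ∑' I : {I : Ideal A // Finite (A ⧸ I)}, 1 / (Nat.card (A ⧸ I.1) : ℂ) ^ s

/-- Absolute convergence of the series defining `idealZeta A s`. -/
def IdealZetaConverges (A : Type*) [CommRing A] (s : ℂ) : Prop :=
  Summable fun I : {I : Ideal A // Finite (A ⧸ I)} => 1 / (Nat.card (A ⧸ I.1) : ℂ) ^ s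

section LocalField

variable (K : Type*) [Field K] [ValuativeRel K]

/-- `𝒪_L`, the integral closure of `𝒪_K` in the `K`-algebra `L`. -/
noncomputable abbrev ringOfIntegers (L : Type*) [CommRing L] [Algebra K L] : Subalgebra 𝒪[K] L :=
  integralClosure 𝒪[K] L

/-- The order `𝒪_n = 𝒪_K[ϖⁿ Δ]`. -/
noncomputable abbrev mainOrder {L : Type*} [CommRing L] [Algebra K L]
    (ϖ : 𝒪[K]) (Δ : L) (n : ℕ) : Subalgebra 𝒪[K] L :=
  Algebra.adjoin 𝒪[K] {ϖ ^ n • Δ}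

/-- `L` is a field, and `𝔪_K 𝒪_L = (π 𝒪_L) ^ e` for a uniformizer `π` of `𝒪_L`: the ramification
degree of the field extension `L / K` is `e`. -/
def IsFieldWithRamification (L : Type*) [CommRing L] [Algebra K L] (e : ℕ) : Prop :=
  IsField L ∧ ∃ π : ringOfIntegers K L, Irreducible π ∧
    Ideal.map (algebraMap 𝒪[K] (ringOfIntegers K L)) 𝓂[K] = Ideal.span {π} ^ e

/-- The ramified case, for `L` of dimension two. -/
def IsRamifiedCase (L : Type*) [CommRing L] [Algebra K L] : Prop :=
  IsFieldWithRamification K L 2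

/-- The unramified case, for `L` of dimension two. -/
def IsUnramifiedCase (L : Type*) [CommRing L] [Algebra K L] : Prop :=
  IsFieldWithRamification K L 1

/-- The split case: `L` is `K × K`, with `K` embedded diagonally. -/
def IsSplitCase (L : Type*) [CommRing L] [Algebra K L] : Prop :=
  Nonempty (L ≃ₐ[K] K × K)

end LocalField

/-- `R_n = 1 + q X² + ⋯ + qⁿ X²ⁿ`. -/
noncomputable def polyR (q n : ℕ) : ℤ[X] :=
  ∑ k ∈ Finset.range (n + 1), (q : ℤ[X]) ^ k * X ^ (2 * k)

/-- `U_0 = 1` and `U_n = (1 + X) R_{n-1} + qⁿ X²ⁿ` for `n ≥ 1`. -/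
noncomputable def polyU (q : ℕ) : ℕ → ℤ[X]
  | 0 => 1
  | n + 1 => (1 + X) * polyR q n + (q : ℤ[X]) ^ (n + 1) * X ^ (2 * (n + 1))

/-- `S_0 = 1` and `S_n = (1 - X) R_{n-1} + qⁿ X²ⁿ` for `n ≥ 1`. -/
noncomputable def polyS (q : ℕ) : ℕ → ℤ[X]
  | 0 => 1
  | n + 1 => (1 - X) * polyR q n + (q : ℤ[X]) ^ (n + 1) * X ^ (2 * (n + 1))

/-! Write `R` for the ring of integers of `K`, `p` for its uniformizer, `X = q⁻ˢ`, and let `f(x) =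
x² - bx - a` be the minimal polynomial of `Δ`, whose coefficients lie in `R`. Then the order of
level `n` is the quadratic algebra `R[ω]` with `ω² = p²ⁿa + pⁿbω`.

In any quadratic algebra over a discrete valuation ring with finite residue field, each ideal of
finite index is uniquely `pᵏ · ker(ω ↦ x mod pᵐ)` with `x` a root modulo `pᵐ` (`rootIdealEquiv`), of
index `q^(2k+m)`. Hence the zeta function is `(1 - X²)⁻¹ ∑ rₘXᵐ`, where `rₘ` counts roots modulo
`pᵐ` (`hasSum_idealZeta`).

Replacing `(a, b)` by `(p²a, pb)` turns the root series `F` into `1 + X + qX²F`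
(`HasRootSeries.mul_pow_two`), so only level `0` remains. There maximality of the order forbids a
root modulo `p²` that is a double root modulo `p` (`not_dvd_of_sq_dvd`), and `F` is `1 + X`, `1` or
`(1 + X)/(1 - X)` in the ramified, unramified and split cases. -/

open scoped nonZeroDivisors

/-! ### Indices of multiples of an ideal -/

/-- Multiplication by `x` is injective and carries `J ⊆ A` to `xJ ⊆ xA`, so it preserves the index.
-/
theorem Ideal.card_quotient_span_singleton_mul {A : Type*} [CommRing A] {x : A} (hx : x ∈ A⁰)
    (J : Ideal A) :
    Nat.card (A ⧸ Ideal.span {x} * J) = Nat.card (A ⧸ Ideal.span {x}) * Nat.card (A ⧸ J) := by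
  have hinj : Function.Injective (AddMonoidHom.mulLeft x) := fun y z h =>
    (mul_cancel_left_mem_nonZeroDivisors hx).1 h
  have h1 : (Ideal.span {x} * J).toAddSubgroup
      = J.toAddSubgroup.map (AddMonoidHom.mulLeft x) := by
    ext y
    simp [Ideal.mem_span_singleton_mul]
  have h2 : (Ideal.span {x}).toAddSubgroup
      = (⊤ : AddSubgroup A).map (AddMonoidHom.mulLeft x) := by
    ext y
    simp [Ideal.mem_span_singleton', mul_comm]
  have h3 := AddSubgroup.relIndex_mul_index
    (H := (Ideal.span {x} * J).toAddSubgroup) (K := (Ideal.span {x}).toAddSubgroup)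
    (Submodule.toAddSubgroup_mono Ideal.mul_le_left)
  rw [h1, h2, AddSubgroup.relIndex_map_map_of_injective _ _ hinj, ← h1, ← h2,
    AddSubgroup.relIndex_top_right, mul_comm] at h3
  exact h3.symm

theorem Ideal.card_quotient_span_singleton_pow {A : Type*} [CommRing A] {x : A} (hx : x ∈ A⁰)
    (k : ℕ) :
    Nat.card (A ⧸ Ideal.span {x ^ k}) = Nat.card (A ⧸ Ideal.span {x}) ^ k := by
  induction k with
  | zero =>
    simp only [pow_zero, Ideal.span_singleton_one]
    exact Nat.card_unique
  | succ k ih =>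
    rw [pow_succ', ← Ideal.span_singleton_mul_span_singleton,
      Ideal.card_quotient_span_singleton_mul hx, ih, pow_succ']

/-! ### Quadratic algebras and evaluation at roots modulo `r` -/

namespace QuadraticAlgebra

variable {R : Type*} [CommRing R] {a b : R}

theorem mem_span_algebraMap {r : R} {z : QuadraticAlgebra R a b} :
    z ∈ Ideal.span {algebraMap R (QuadraticAlgebra R a b) r} ↔ r ∣ z.re ∧ r ∣ z.im := by
  rw [Ideal.mem_span_singleton, algebraMap_dvd_iff]

theorem algebraMap_mem_nonZeroDivisors {r : R} (hr : r ∈ R⁰) :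
    algebraMap R (QuadraticAlgebra R a b) r ∈ (QuadraticAlgebra R a b)⁰ :=
  algebraMap_mem_nonZeroDivisors_iff.2 hr

theorem card_quotient_span_algebraMap (r : R) :
    Nat.card (QuadraticAlgebra R a b ⧸ Ideal.span {algebraMap R (QuadraticAlgebra R a b) r})
      = Nat.card (R ⧸ Ideal.span {r}) ^ 2 := by
  let f : QuadraticAlgebra R a b →+ (R ⧸ Ideal.span {r}) × (R ⧸ Ideal.span {r}) :=
    { toFun := fun z => (Ideal.Quotient.mk _ z.re, Ideal.Quotient.mk _ z.im)
      map_zero' := by simp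
      map_add' := by simp }
  have hf : Function.Surjective f := by
    rintro ⟨x, y⟩
    obtain ⟨x, rfl⟩ := Ideal.Quotient.mk_surjective x
    obtain ⟨y, rfl⟩ := Ideal.Quotient.mk_surjective y
    exact ⟨⟨x, y⟩, rfl⟩
  have hk : f.ker
      = (Ideal.span {algebraMap R (QuadraticAlgebra R a b) r}).toAddSubgroup := by
    ext z
    simp only [AddMonoidHom.mem_ker, Submodule.mem_toAddSubgroup, mem_span_algebraMap]
    simp [f, Ideal.Quotient.eq_zero_iff_mem, Ideal.mem_span_singleton]
  have := AddSubgroup.index_ker f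
  rw [hk, AddMonoidHom.range_eq_top.2 hf] at this
  refine Eq.trans this ?_
  rw [Nat.card_congr AddSubgroup.topEquiv.toEquiv, Nat.card_prod, sq]

variable (a b) in
/-- The solutions of `x² = a + b x` modulo `r`. -/
abbrev RootsMod (r : R) : Type _ :=
  {x : R ⧸ Ideal.span {r} // x * x = a • 1 + b • x}

/-- The homomorphism to `R ⧸ r` sending `ω` to a root modulo `r`. -/
def evalMod {r : R} (x : RootsMod a b r) : QuadraticAlgebra R a b →ₐ[R] R ⧸ Ideal.span {r} :=
  lift x

theorem evalMod_apply {r : R} (x : RootsMod a b r) (z : QuadraticAlgebra R a b) :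
    evalMod x z = z.re • 1 + z.im • x.1 := rfl

theorem evalMod_surjective {r : R} (x : RootsMod a b r) : Function.Surjective (evalMod x) := by
  intro y
  obtain ⟨y, rfl⟩ := Ideal.Quotient.mk_surjective y
  exact ⟨algebraMap R _ y, by simp⟩

theorem card_quotient_ker_evalMod {r : R} (x : RootsMod a b r) :
    Nat.card (QuadraticAlgebra R a b ⧸ RingHom.ker (evalMod x))
      = Nat.card (R ⧸ Ideal.span {r}) :=
  Nat.card_congr (RingHom.quotientKerEquivOfSurjective (evalMod_surjective x)).toEquiv

theorem algebraMap_mem_ker_evalMod {r : R} (x : RootsMod a b r) (y : R) :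
    algebraMap R _ y ∈ RingHom.ker (evalMod x) ↔ r ∣ y := by
  rw [RingHom.mem_ker, AlgHom.commutes]
  exact Ideal.Quotient.eq_zero_iff_mem.trans Ideal.mem_span_singleton

theorem omega_sub_mem_ker_evalMod {r : R} (x : RootsMod a b r) (y : R) :
    ω - algebraMap R _ y ∈ RingHom.ker (evalMod x) ↔ x.1 = Ideal.Quotient.mk _ y := by
  rw [RingHom.mem_ker, map_sub, AlgHom.commutes, sub_eq_zero]
  simp [evalMod_apply]

end QuadraticAlgebra

/-! ### Classification of the ideals of finite index -/

theorem Ideal.mul_mem_span_singleton_mul {A : Type*} [CommRing A] {x : A} (hx : x ∈ A⁰)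
    {J : Ideal A} {y : A} : x * y ∈ Ideal.span {x} * J ↔ y ∈ J := by
  rw [Ideal.mem_span_singleton_mul]
  constructor
  · rintro ⟨z, hz, h⟩
    rwa [← (mul_cancel_left_mem_nonZeroDivisors hx).1 h]
  · exact fun h => ⟨y, h, rfl⟩

/-- Two powers of `x` agree modulo `I`, so `xⁱ(1 - xʲ⁻ⁱ) ∈ I` for some `i < j`, and the second
factor is a unit. -/
theorem Ideal.exists_pow_mem_of_finite_quotient {A : Type*} [CommRing A] (I : Ideal A)
    [Finite (A ⧸ I)] {x : A} (hx : ∀ n : ℕ, n ≠ 0 → IsUnit (1 - x ^ n)) : ∃ n : ℕ, x ^ n ∈ I := by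
  obtain ⟨i, j, hij, h⟩ :=
    Finite.exists_ne_map_eq_of_infinite fun n : ℕ => Ideal.Quotient.mk I (x ^ n)
  wlog hlt : i < j generalizing i j
  · exact this j i hij.symm h.symm (lt_of_le_of_ne (not_lt.1 hlt) hij.symm)
  refine ⟨i, ?_⟩
  have h1 : x ^ i * (1 - x ^ (j - i)) ∈ I := by
    rw [mul_sub, mul_one, ← pow_add, Nat.add_sub_cancel' hlt.le]
    exact Ideal.Quotient.eq.1 h
  exact (Ideal.mul_unit_mem_iff_mem I (hx (j - i) (by omega))).1 h1

namespace QuadraticAlgebra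

variable {R : Type*} [CommRing R] [IsDomain R] {a b p : R}

/-- The ideal `p ^ k • ker (ω ↦ x)` for a root `x` modulo `p ^ m`. -/
def rootIdeal (d : ℕ × Σ m : ℕ, RootsMod a b (p ^ m)) : Ideal (QuadraticAlgebra R a b) :=
  Ideal.span {algebraMap R _ (p ^ d.1)} * RingHom.ker (evalMod d.2.2)

theorem algebraMap_pow_mem_nonZeroDivisors (hp : p ≠ 0) (k : ℕ) :
    algebraMap R (QuadraticAlgebra R a b) (p ^ k) ∈ (QuadraticAlgebra R a b)⁰ :=
  algebraMap_mem_nonZeroDivisors (mem_nonZeroDivisors_of_ne_zero (pow_ne_zero k hp))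

theorem card_quotient_rootIdeal (hp : p ≠ 0) (d : ℕ × Σ m : ℕ, RootsMod a b (p ^ m)) :
    Nat.card (QuadraticAlgebra R a b ⧸ rootIdeal d)
      = Nat.card (R ⧸ Ideal.span {p}) ^ (2 * d.1 + d.2.1) := by
  have hp' : p ∈ R⁰ := mem_nonZeroDivisors_of_ne_zero hp
  rw [rootIdeal, Ideal.card_quotient_span_singleton_mul (algebraMap_pow_mem_nonZeroDivisors hp _),
    card_quotient_span_algebraMap, card_quotient_ker_evalMod,
    Ideal.card_quotient_span_singleton_pow hp', Ideal.card_quotient_span_singleton_pow hp',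
    ← pow_mul, ← pow_add, mul_comm 2]

/-- This recovers the exponent `k` from the ideal: the kernel contains some `ω - y`, whose
`ω`-coordinate is `1`, so no further power of `p` divides the ideal. -/
theorem rootIdeal_le_iff (hp : Irreducible p) (d : ℕ × Σ m : ℕ, RootsMod a b (p ^ m)) (j : ℕ) :
    rootIdeal d ≤ Ideal.span {algebraMap R _ (p ^ j)} ↔ j ≤ d.1 := by
  constructor
  · intro h
    obtain ⟨y, hy⟩ := Ideal.Quotient.mk_surjective d.2.2.1
    have h1 : algebraMap R _ (p ^ d.1) * (ω - algebraMap R _ y) ∈ rootIdeal d :=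
      Ideal.mul_mem_mul (Ideal.mem_span_singleton_self _)
        ((omega_sub_mem_ker_evalMod _ _).2 hy.symm)
    have h2 := (mem_span_algebraMap.1 (h h1)).2
    simp only [im_mul, algebraMap_re, algebraMap_im, im_sub, omega_im, re_sub, omega_re] at h2
    exact (pow_dvd_pow_iff hp.ne_zero hp.not_isUnit).1 (by simpa using h2)
  · intro h
    refine Ideal.mul_le_left.trans ?_
    rw [Ideal.span_singleton_le_span_singleton]
    exact map_dvd _ (pow_dvd_pow p h)

/-- Once `pᵏ` is cancelled, `m` is read off from the intersection of the kernel with `R`, and `x`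
from the elements `ω - y` of the kernel. -/
theorem rootIdeal_injective (hp : Irreducible p) :
    Function.Injective (rootIdeal (a := a) (b := b) (p := p)) := by
  rintro ⟨k, m, x⟩ ⟨k', m', x'⟩ h
  obtain rfl : k = k' := by
    refine le_antisymm ?_ ?_
    · exact (rootIdeal_le_iff hp ⟨k', m', x'⟩ k).1 (h ▸ (rootIdeal_le_iff hp _ _).2 le_rfl)
    · exact (rootIdeal_le_iff hp ⟨k, m, x⟩ k').1 (h ▸ (rootIdeal_le_iff hp _ _).2 le_rfl)
  have hker : ∀ z, z ∈ RingHom.ker (evalMod x) ↔ z ∈ RingHom.ker (evalMod x') := by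
    intro z
    have hz := algebraMap_pow_mem_nonZeroDivisors (a := a) (b := b) hp.ne_zero k
    exact (Ideal.mul_mem_span_singleton_mul hz).symm.trans
      ((iff_of_eq (congrArg (algebraMap R _ (p ^ k) * z ∈ ·) h)).trans
        (Ideal.mul_mem_span_singleton_mul hz))
  have hdvd : ∀ y, p ^ m ∣ y ↔ p ^ m' ∣ y := fun y => by
    rw [← algebraMap_mem_ker_evalMod x, ← algebraMap_mem_ker_evalMod x', hker]
  obtain rfl : m = m' := le_antisymm
    ((pow_dvd_pow_iff hp.ne_zero hp.not_isUnit).1 ((hdvd _).2 dvd_rfl))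
    ((pow_dvd_pow_iff hp.ne_zero hp.not_isUnit).1 ((hdvd _).1 dvd_rfl))
  obtain ⟨y, hy⟩ := Ideal.Quotient.mk_surjective x.1
  have hx' := (omega_sub_mem_ker_evalMod x' y).1
    ((hker _).1 ((omega_sub_mem_ker_evalMod x y).2 hy.symm))
  obtain rfl : x = x' := Subtype.ext (hy.symm.trans hx'.symm)
  rfl

variable [IsDiscreteValuationRing R]

theorem isUnit_iff_not_dvd_of_irreducible (hp : Irreducible p) {r : R} : IsUnit r ↔ ¬ p ∣ r := by
  rw [← not_iff_not, not_not, ← mem_nonunits_iff, ← IsLocalRing.mem_maximalIdeal,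
    hp.maximalIdeal_eq, Ideal.mem_span_singleton]

/-- An element of `J` with unit `ω`-coordinate rescales to some `ω - c ∈ J`. Then `R` surjects onto
the quotient by `J`, and `J` is determined by `c` and by `J ∩ R = (pᵐ)`. -/
theorem exists_ker_evalMod_eq (hp : Irreducible p) {J : Ideal (QuadraticAlgebra R a b)}
    (hJ : ¬ J ≤ Ideal.span {algebraMap R _ p}) {N : ℕ} (hN : algebraMap R _ (p ^ N) ∈ J) :
    ∃ (m : ℕ) (x : RootsMod a b (p ^ m)), RingHom.ker (evalMod x) = J := by
  have hunit : ∃ z ∈ J, IsUnit z.im := by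
    obtain ⟨z, hz, hzp⟩ := SetLike.not_le_iff_exists.1 hJ
    rw [mem_span_algebraMap] at hzp
    by_cases him : p ∣ z.im
    -- The `ω`-coordinate of `ωz` is `z.re + b z.im`, a unit because `p` divides `z.im` but not
    -- `z.re`.
    · refine ⟨ω * z, J.mul_mem_left _ hz, ?_⟩
      rw [isUnit_iff_not_dvd_of_irreducible hp]
      intro h
      simp only [im_mul, omega_re, omega_im, zero_mul, one_mul, zero_add, mul_one] at h
      exact hzp ⟨(dvd_add_left (him.mul_left b)).1 h, him⟩
    · exact ⟨z, hz, (isUnit_iff_not_dvd_of_irreducible hp).2 him⟩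
  obtain ⟨c, hc⟩ : ∃ c : R, ω - algebraMap R _ c ∈ J := by
    obtain ⟨z, hz, hu⟩ := hunit
    obtain ⟨v, hv⟩ := hu.exists_left_inv
    refine ⟨-(v * z.re), ?_⟩
    convert J.mul_mem_left (algebraMap R _ v) hz using 1
    ext <;> simp [hv]
  have hred : ∀ z : QuadraticAlgebra R a b,
      z ∈ J ↔ algebraMap R _ (z.re + z.im * c) ∈ J := by
    intro z
    have : z = algebraMap R _ (z.re + z.im * c) + algebraMap R _ z.im * (ω - algebraMap R _ c) := by
      ext <;> simp
    conv_lhs => rw [this]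
    exact J.add_mem_iff_left (J.mul_mem_left _ hc)
  obtain ⟨m, hm⟩ := IsDiscreteValuationRing.ideal_eq_span_pow_irreducible
    (s := J.comap (algebraMap R (QuadraticAlgebra R a b)))
    (fun h => pow_ne_zero N hp.ne_zero (by
      rw [← Ideal.mem_bot, ← h]; exact hN)) hp
  have hm' : ∀ y : R, algebraMap R _ y ∈ J ↔ p ^ m ∣ y := fun y => by
    rw [← Ideal.mem_comap, hm, Ideal.mem_span_singleton]
  have hroot : p ^ m ∣ c * c - (a + b * c) := by
    rw [← hm']
    -- The multiplier is the conjugate of `ω - c`, so the product is its norm `c² - bc - a`.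
    convert J.mul_mem_left (-(ω + algebraMap R _ (c - b))) hc using 1
    ext
    · simp
      ring
    · simp
  refine ⟨m, ⟨Ideal.Quotient.mk _ c, ?_⟩, ?_⟩
  · exact Ideal.Quotient.eq.2 (Ideal.mem_span_singleton.2 (by simpa using hroot))
  · ext z
    rw [hred, hm', RingHom.mem_ker, evalMod_apply]
    rw [show z.re • (1 : R ⧸ Ideal.span {p ^ m}) + z.im • Ideal.Quotient.mk (Ideal.span {p ^ m}) c
      = Ideal.Quotient.mk _ (z.re • 1 + z.im • c) from rfl, Ideal.Quotient.eq_zero_iff_mem,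
      Ideal.mem_span_singleton, smul_eq_mul, smul_eq_mul, mul_one]

theorem exists_rootIdeal_eq (hp : Irreducible p) (I : Ideal (QuadraticAlgebra R a b))
    [Finite (QuadraticAlgebra R a b ⧸ I)] :
    ∃ d : ℕ × Σ m : ℕ, RootsMod a b (p ^ m), rootIdeal d = I := by
  obtain ⟨N, hN⟩ := I.exists_pow_mem_of_finite_quotient (x := algebraMap R _ p) fun n hn => by
    rw [← map_pow, ← map_one (algebraMap R (QuadraticAlgebra R a b)), ← map_sub]
    refine IsUnit.map _ ((isUnit_iff_not_dvd_of_irreducible hp).2 fun h => ?_)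
    exact hp.not_dvd_one ((dvd_sub_left (dvd_pow_self p hn)).1 h)
  rw [← map_pow] at hN
  have hex : ∃ k : ℕ, ¬ I ≤ Ideal.span {algebraMap R _ (p ^ (k + 1))} := by
    refine ⟨N, fun h => ?_⟩
    have := (mem_span_algebraMap.1 (h hN)).1
    rw [algebraMap_re, pow_dvd_pow_iff hp.ne_zero hp.not_isUnit] at this
    omega
  classical
  obtain ⟨k, hk, hk'⟩ : ∃ k : ℕ, I ≤ Ideal.span {algebraMap R _ (p ^ k)} ∧
      ¬ I ≤ Ideal.span {algebraMap R _ (p ^ (k + 1))} := by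
    refine ⟨Nat.find hex, ?_, Nat.find_spec hex⟩
    rcases h : Nat.find hex with - | k
    · simp
    · exact not_not.1 (Nat.find_min hex (m := k) (by omega))
  set x := algebraMap R (QuadraticAlgebra R a b) (p ^ k) with hx
  -- With `k` the largest exponent such that `pᵏ` divides `I`, this is `p⁻ᵏI`.
  let J : Ideal (QuadraticAlgebra R a b) := Submodule.comap (LinearMap.mulLeft _ x) I
  have hIJ : Ideal.span {x} * J = I := by
    ext z
    rw [Ideal.mem_span_singleton_mul]
    constructor
    · rintro ⟨y, hy, rfl⟩
      exact hy
    · intro hz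
      obtain ⟨y, rfl⟩ := Ideal.mem_span_singleton.1 (hk hz)
      exact ⟨y, hz, rfl⟩
  have hJ : ¬ J ≤ Ideal.span {algebraMap R _ p} := fun h => hk' <| by
    rw [← hIJ, pow_succ, map_mul, ← Ideal.span_singleton_mul_span_singleton]
    exact Ideal.mul_mono_right h
  obtain ⟨m, y, hy⟩ := exists_ker_evalMod_eq hp hJ (N := N) (I.mul_mem_left x hN)
  exact ⟨⟨k, m, y⟩, by rw [rootIdeal, hy, hIJ]⟩

/-- The ideals of finite index of a quadratic algebra over a discrete valuation ring with
uniformizer `p` are parametrized by a power of `p` and a root modulo another power of `p`. -/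
noncomputable def rootIdealEquiv (hp : Irreducible p) [Finite (R ⧸ Ideal.span {p})] :
    (ℕ × Σ m : ℕ, RootsMod a b (p ^ m)) ≃
      {I : Ideal (QuadraticAlgebra R a b) // Finite (QuadraticAlgebra R a b ⧸ I)} :=
  Equiv.ofBijective
    (fun d => ⟨rootIdeal d, Nat.finite_of_card_ne_zero (by
      rw [card_quotient_rootIdeal hp.ne_zero]
      exact pow_ne_zero _ Nat.card_pos.ne')⟩)
    ⟨fun _ _ h => rootIdeal_injective hp (Subtype.ext_iff.1 h), fun ⟨I, hI⟩ => by
      obtain ⟨d, hd⟩ := exists_rootIdeal_eq hp I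
      exact ⟨d, Subtype.ext hd⟩⟩

end QuadraticAlgebra

/-! ### Counting roots modulo powers of `p`, and the zeta function as a root series -/

theorem AddMonoidHom.card_preimage_of_surjective {G H : Type*} [AddGroup G] [AddGroup H]
    {f : G →+ H} (hf : Function.Surjective f) (P : H → Prop) [Finite {x // P x}] :
    Nat.card {y : G // P (f y)} = Nat.card f.ker * Nat.card {x : H // P x} := by
  let e : {y : G // P (f y)} ≃ {x : H // P x} × f.ker :=
    (Equiv.sigmaFiberEquiv fun y : {y : G // P (f y)} => (⟨f y, y.2⟩ : {x : H // P x})).symm.trans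
      ((Equiv.sigmaCongrRight fun x =>
        ({ toFun := fun y => ⟨y.1.1, congrArg Subtype.val y.2⟩
           invFun := fun y => ⟨⟨y.1, by
              have : f y.1 = x.1 := y.2
              rw [this]; exact x.2⟩, Subtype.ext y.2⟩
           left_inv := fun _ => rfl
           right_inv := fun _ => rfl } : _ ≃ f ⁻¹' {x.1}).trans
          (f.fiberEquivKerOfSurjective hf x.1)).trans (Equiv.sigmaEquivProd _ _))
  rw [Nat.card_congr e, Nat.card_prod, mul_comm]

namespace QuadraticAlgebra

variable {R : Type*} [CommRing R] {a b p : R}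

theorem mk_mem_rootsMod_iff {r y : R} :
    (Ideal.Quotient.mk (Ideal.span {r}) y * Ideal.Quotient.mk (Ideal.span {r}) y
      = a • 1 + b • Ideal.Quotient.mk (Ideal.span {r}) y) ↔ r ∣ y * y - (a + b * y) := by
  rw [← Ideal.mem_span_singleton, ← Ideal.Quotient.eq]
  simp only [map_mul, map_add]
  have : ∀ c : R, c • (1 : R ⧸ Ideal.span {r}) = Ideal.Quotient.mk _ c := fun c => by
    rw [← mul_one (Ideal.Quotient.mk _ c)]; rfl
  rw [this]
  rfl

theorem finite_quotient_span_pow [IsDomain R] (hp : p ≠ 0) [Finite (R ⧸ Ideal.span {p})] (m : ℕ) :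
    Finite (R ⧸ Ideal.span {p ^ m}) := Nat.finite_of_card_ne_zero (by
  rw [Ideal.card_quotient_span_singleton_pow (mem_nonZeroDivisors_of_ne_zero hp)]
  exact pow_ne_zero _ Nat.card_pos.ne')

theorem card_rootsMod_pow_zero : Nat.card (RootsMod a b (p ^ 0)) = 1 := by
  have : Subsingleton (R ⧸ Ideal.span {p ^ 0}) :=
    Ideal.Quotient.subsingleton_iff.2 (by simp)
  exact Nat.card_eq_one_iff_unique.2 ⟨inferInstance, ⟨⟨0, Subsingleton.elim _ _⟩⟩⟩

theorem card_rootsMod_eq_one_of_forall {r c : R} (hc : r ∣ c * c - (a + b * c))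
    (h : ∀ y, r ∣ y * y - (a + b * y) → r ∣ y - c) : Nat.card (RootsMod a b r) = 1 := by
  refine Nat.card_eq_one_iff_exists.2 ⟨⟨Ideal.Quotient.mk _ c, mk_mem_rootsMod_iff.2 hc⟩, ?_⟩
  rintro ⟨y, hy⟩
  obtain ⟨y, rfl⟩ := Ideal.Quotient.mk_surjective y
  exact Subtype.ext (Ideal.Quotient.eq.2 (Ideal.mem_span_singleton.2
    (h y (mk_mem_rootsMod_iff.1 hy))))

theorem card_rootsMod_eq_zero_of_forall {r : R} (h : ∀ y, ¬ r ∣ y * y - (a + b * y)) :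
    Nat.card (RootsMod a b r) = 0 := by
  have : IsEmpty (RootsMod a b r) := ⟨fun ⟨y, hy⟩ => by
    obtain ⟨y, rfl⟩ := Ideal.Quotient.mk_surjective y
    exact h y (mk_mem_rootsMod_iff.1 hy)⟩
  exact Nat.card_of_isEmpty

theorem card_rootsMod_eq_two_of_forall {r c d : R} (hc : r ∣ c * c - (a + b * c))
    (hd : r ∣ d * d - (a + b * d)) (hcd : ¬ r ∣ c - d)
    (h : ∀ y, r ∣ y * y - (a + b * y) → r ∣ y - c ∨ r ∣ y - d) :
    Nat.card (RootsMod a b r) = 2 := by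
  refine Nat.card_eq_two_iff.2 ⟨⟨Ideal.Quotient.mk _ c, mk_mem_rootsMod_iff.2 hc⟩,
    ⟨Ideal.Quotient.mk _ d, mk_mem_rootsMod_iff.2 hd⟩, ?_, ?_⟩
  · intro heq
    exact hcd (Ideal.mem_span_singleton.1 (Ideal.Quotient.eq.1 (Subtype.ext_iff.1 heq)))
  · refine Set.eq_univ_of_forall ?_
    rintro ⟨y, hy⟩
    obtain ⟨y, rfl⟩ := Ideal.Quotient.mk_surjective y
    refine (h y (mk_mem_rootsMod_iff.1 hy)).imp (fun h => ?_) (fun h => ?_) <;>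
    exact Subtype.ext (Ideal.Quotient.eq.2 (Ideal.mem_span_singleton.2 h))

theorem card_rootsMod_mul_pow_one (hp : Prime p) :
    Nat.card (RootsMod (p ^ 2 * a) (p * b) (p ^ 1)) = 1 := by
  refine card_rootsMod_eq_one_of_forall (c := 0) ?_ fun y hy => ?_
  · rw [pow_one]
    exact ⟨-(p * a), by ring⟩
  · rw [pow_one] at *
    have : p ∣ y * y := (dvd_sub_left (a := p) ⟨p * a + b * y, by ring⟩).1 hy
    rw [sub_zero]
    exact (hp.dvd_or_dvd this).elim id id

/-- A root of the rescaled equation is `py` with `y` taken modulo `pᵐ⁺¹`. Dividing by `p²`, the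
condition on `y` is to be a root of the original equation modulo `pᵐ`, and each residue modulo `pᵐ`
has `q` lifts modulo `pᵐ⁺¹`. -/
theorem card_rootsMod_mul_pow_add_two [IsDomain R] (hp : Prime p) [Finite (R ⧸ Ideal.span {p})]
    (m : ℕ) :
    Nat.card (RootsMod (p ^ 2 * a) (p * b) (p ^ (m + 2)))
      = Nat.card (R ⧸ Ideal.span {p}) * Nat.card (RootsMod a b (p ^ m)) := by
  have hfin := fun k => finite_quotient_span_pow (p := p) hp.ne_zero k
  let f : R ⧸ Ideal.span {p ^ (m + 1)} →+* R ⧸ Ideal.span {p ^ m} :=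
    Ideal.Quotient.factor (Ideal.span_singleton_le_span_singleton.2 (pow_dvd_pow p (Nat.le_succ m)))
  have hf : Function.Surjective f := Ideal.Quotient.factor_surjective _
  have hker : Nat.card f.toAddMonoidHom.ker = Nat.card (R ⧸ Ideal.span {p}) := by
    have h1 := AddSubgroup.card_mul_index f.toAddMonoidHom.ker
    have hp' : p ∈ R⁰ := mem_nonZeroDivisors_of_ne_zero hp.ne_zero
    have hrange : f.toAddMonoidHom.range = ⊤ := AddMonoidHom.range_eq_top.2 hf
    rw [AddSubgroup.index_ker, hrange,
      Nat.card_congr AddSubgroup.topEquiv.toEquiv,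
      Ideal.card_quotient_span_singleton_pow hp', Ideal.card_quotient_span_singleton_pow hp',
      pow_succ' (Nat.card _) m] at h1
    exact Nat.eq_of_mul_eq_mul_right (pow_pos Nat.card_pos m) h1
  have h2 := f.toAddMonoidHom.card_preimage_of_surjective hf
    (fun x : R ⧸ Ideal.span {p ^ m} => x * x = a • 1 + b • x)
  rw [hker] at h2
  rw [← h2]
  -- Multiplication by `p`; it restricts to the bijection `y ↦ py` from lifts of roots onto roots.
  let g : R ⧸ Ideal.span {p ^ (m + 1)} →ₗ[R] R ⧸ Ideal.span {p ^ (m + 2)} :=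
    Submodule.mapQ _ _ (LinearMap.mulLeft R p) (by
      intro y hy
      rw [Ideal.mem_span_singleton] at hy
      exact Ideal.mem_span_singleton.2 (by
        rw [pow_succ']
        exact mul_dvd_mul_left p hy))
  have hg : ∀ y : R, g (Ideal.Quotient.mk _ y) = Ideal.Quotient.mk _ (p * y) := fun _ => rfl
  have hfy : ∀ y : R, f.toAddMonoidHom (Ideal.Quotient.mk _ y) = Ideal.Quotient.mk _ y :=
    fun _ => rfl
  have hroot : ∀ y : R, p ^ (m + 2) ∣ (p * y) * (p * y) - (p ^ 2 * a + p * b * (p * y)) ↔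
      p ^ m ∣ y * y - (a + b * y) := fun y => by
    rw [show (p * y) * (p * y) - (p ^ 2 * a + p * b * (p * y)) = p ^ 2 * (y * y - (a + b * y)) by
      ring, pow_add, mul_comm (p ^ m)]
    exact mul_dvd_mul_iff_left (pow_ne_zero 2 hp.ne_zero)
  symm
  refine Nat.card_congr (Equiv.ofBijective (fun y => ⟨g y.1, ?_⟩) ⟨?_, ?_⟩)
  · obtain ⟨y, hy⟩ := y
    obtain ⟨y, rfl⟩ := Ideal.Quotient.mk_surjective y
    rw [hfy, mk_mem_rootsMod_iff] at hy
    rw [hg, mk_mem_rootsMod_iff, hroot]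
    exact hy
  · rintro ⟨y, hy⟩ ⟨z, hz⟩ h
    obtain ⟨y, rfl⟩ := Ideal.Quotient.mk_surjective y
    obtain ⟨z, rfl⟩ := Ideal.Quotient.mk_surjective z
    have h' := Subtype.ext_iff.1 h
    simp only [hg] at h'
    rw [Ideal.Quotient.eq, Ideal.mem_span_singleton, ← mul_sub, pow_succ',
      mul_dvd_mul_iff_left hp.ne_zero] at h'
    exact Subtype.ext (Ideal.Quotient.eq.2 (Ideal.mem_span_singleton.2 h'))
  · rintro ⟨x, hx⟩
    obtain ⟨x, rfl⟩ := Ideal.Quotient.mk_surjective x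
    have hx' := mk_mem_rootsMod_iff.1 hx
    obtain ⟨y, rfl⟩ : p ∣ x := by
      have h1 : p ∣ x * x - (p ^ 2 * a + p * b * x) := (dvd_pow_self p (by omega)).trans hx'
      have h3 : p ∣ x * x := (dvd_sub_left (a := p) ⟨p * a + b * x, by ring⟩).1 h1
      exact (hp.dvd_or_dvd h3).elim id id
    refine ⟨⟨Ideal.Quotient.mk _ y, ?_⟩, Subtype.ext (hg y)⟩
    rw [hfy, mk_mem_rootsMod_iff]
    exact (hroot y).1 hx'

variable (a b p) in
/-- `∑ₘ rₘ Xᵐ = z`, where `rₘ` is the number of solutions of `x² = a + b x` modulo `pᵐ`. -/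
def HasRootSeries (X z : ℂ) : Prop :=
  HasSum (fun m : ℕ => (Nat.card (RootsMod a b (p ^ m)) : ℂ) * X ^ m) z

theorem HasRootSeries.mul_pow_two [IsDomain R] (hp : Prime p) [Finite (R ⧸ Ideal.span {p})]
    {X z : ℂ} (h : HasRootSeries a b p X z) :
    HasRootSeries (p ^ 2 * a) (p * b) p X
      (1 + X + Nat.card (R ⧸ Ideal.span {p}) * X ^ 2 * z) := by
  rw [HasRootSeries, ← hasSum_nat_add_iff' 2]
  simp only [Finset.sum_range_succ, Finset.sum_range_zero, card_rootsMod_pow_zero,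
    card_rootsMod_mul_pow_one hp, card_rootsMod_mul_pow_add_two hp]
  have h1 := HasSum.mul_left (Nat.card (R ⧸ Ideal.span {p}) * X ^ 2 : ℂ) h
  have h2 : 1 + X + Nat.card (R ⧸ Ideal.span {p}) * X ^ 2 * z
      - (0 + ((1 : ℕ) : ℂ) * X ^ 0 + ((1 : ℕ) : ℂ) * X ^ 1)
      = Nat.card (R ⧸ Ideal.span {p}) * X ^ 2 * z := by
    push_cast
    ring
  rw [h2]
  refine h1.congr_fun fun m => ?_
  push_cast
  ring

/-- The exponent `k` contributes a geometric series in `X²`; absolute convergence permits grouping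
the roots by `m` and multiplying the two sums. -/
theorem HasRootSeries.hasSum_prod [∀ m : ℕ, Finite (RootsMod a b (p ^ m))] {X z : ℂ} (hX : ‖X‖ < 1)
    (h : HasRootSeries a b p X z) :
    HasSum (fun d : ℕ × Σ m : ℕ, RootsMod a b (p ^ m) => (X ^ 2) ^ d.1 * X ^ d.2.1)
      ((1 - X ^ 2)⁻¹ * z) := by
  have hX2 : ‖X ^ 2‖ < 1 := by
    rw [norm_pow]
    exact pow_lt_one₀ (norm_nonneg _) hX two_ne_zero
  have hgeom : HasSum (fun k : ℕ => (X ^ 2) ^ k) (1 - X ^ 2)⁻¹ :=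
    hasSum_geometric_of_norm_lt_one hX2
  have hnorm : Summable fun d : Σ m : ℕ, RootsMod a b (p ^ m) => ‖X ^ d.1‖ := by
    rw [summable_sigma_of_nonneg fun _ => norm_nonneg _]
    refine ⟨fun m => Summable.of_finite, ?_⟩
    refine h.summable.norm.congr fun m => ?_
    change _ = ∑' _ : RootsMod a b (p ^ m), ‖X ^ m‖
    rw [tsum_const, norm_mul, Complex.norm_natCast, nsmul_eq_mul]
  have hsig : HasSum (fun d : Σ m : ℕ, RootsMod a b (p ^ m) => X ^ d.1) z := by
    have h1 := hnorm.of_norm.hasSum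
    have h2 := h1.sigma (g := fun m : ℕ => (Nat.card (RootsMod a b (p ^ m)) : ℂ) * X ^ m)
      fun m => by
        have := Fintype.ofFinite (RootsMod a b (p ^ m))
        have h3 := hasSum_fintype fun _ : RootsMod a b (p ^ m) => X ^ m
        rwa [Finset.sum_const, Finset.card_univ, ← Nat.card_eq_fintype_card, nsmul_eq_mul] at h3
    rwa [h2.unique h] at h1
  have hgeom' : Summable fun k : ℕ => ‖(X ^ 2) ^ k‖ := by
    simpa only [norm_pow] using summable_geometric_of_lt_one (norm_nonneg _) hX2
  have hprod := summable_mul_of_summable_norm (f := fun k : ℕ => (X ^ 2) ^ k)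
    (g := fun d : Σ m : ℕ, RootsMod a b (p ^ m) => X ^ d.1) hgeom' hnorm
  have hmul := HasSum.mul (f := fun k : ℕ => (X ^ 2) ^ k)
    (g := fun d : Σ m : ℕ, RootsMod a b (p ^ m) => X ^ d.1) hgeom hsig hprod
  exact hmul

variable [IsDomain R] [IsDiscreteValuationRing R]

theorem hasSum_idealZeta (hp : Irreducible p) [Finite (R ⧸ Ideal.span {p})] {s z : ℂ}
    (hX : ‖(Nat.card (R ⧸ Ideal.span {p}) : ℂ) ^ (-s)‖ < 1)
    (h : HasRootSeries a b p ((Nat.card (R ⧸ Ideal.span {p}) : ℂ) ^ (-s)) z) :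
    HasSum (fun I : {I : Ideal (QuadraticAlgebra R a b) // Finite (QuadraticAlgebra R a b ⧸ I)} =>
        1 / (Nat.card (QuadraticAlgebra R a b ⧸ I.1) : ℂ) ^ s)
      ((1 - ((Nat.card (R ⧸ Ideal.span {p}) : ℂ) ^ (-s)) ^ 2)⁻¹ * z) := by
  have hfin := fun k => finite_quotient_span_pow (p := p) hp.ne_zero k
  rw [← (rootIdealEquiv hp).hasSum_iff]
  refine (h.hasSum_prod hX).congr_fun fun d => ?_
  have h1 : ((rootIdealEquiv hp) d).1 = rootIdeal d := rfl
  simp only [Function.comp, h1, card_quotient_rootIdeal hp.ne_zero]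
  rw [one_div, ← Complex.cpow_neg, Nat.cast_pow, ← Complex.natCast_cpow_natCast_mul,
    mul_comm, Complex.cpow_mul_nat, ← pow_mul, pow_add]

end QuadraticAlgebra

/-! ### Evaluating the polynomials; invariance of the zeta function under isomorphism -/

theorem aeval_polyR (q n : ℕ) (X : ℂ) :
    aeval X (polyR q n) = ∑ k ∈ Finset.range (n + 1), (q : ℂ) ^ k * X ^ (2 * k) := by
  simp [polyR]

theorem polyU_eq_sum (q n : ℕ) :
    polyU q n = ∑ k ∈ Finset.range n,
        ((q : ℤ[X]) ^ k * X ^ (2 * k) + (q : ℤ[X]) ^ k * X ^ (2 * k + 1))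
      + (q : ℤ[X]) ^ n * X ^ (2 * n) := by
  cases n with
  | zero => simp [polyU]
  | succ n =>
    rw [polyU, polyR, Finset.mul_sum]
    exact congrArg (· + _) (Finset.sum_congr rfl fun k _ => by ring)

theorem polyS_eq_sum (q n : ℕ) :
    polyS q n = ∑ k ∈ Finset.range n,
        ((q : ℤ[X]) ^ k * X ^ (2 * k) - (q : ℤ[X]) ^ k * X ^ (2 * k + 1))
      + (q : ℤ[X]) ^ n * X ^ (2 * n) := by
  cases n with
  | zero => simp [polyS]
  | succ n =>
    rw [polyS, polyR, Finset.mul_sum]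
    exact congrArg (· + _) (Finset.sum_congr rfl fun k _ => by ring)

theorem aeval_polyU (q n : ℕ) (X : ℂ) :
    aeval X (polyU q n) = (1 + X) * ∑ k ∈ Finset.range n, (q : ℂ) ^ k * X ^ (2 * k)
      + (q : ℂ) ^ n * X ^ (2 * n) := by
  cases n with
  | zero => simp [polyU]
  | succ n => simp [polyU, aeval_polyR]

theorem aeval_polyS (q n : ℕ) (X : ℂ) :
    aeval X (polyS q n) = (1 - X) * ∑ k ∈ Finset.range n, (q : ℂ) ^ k * X ^ (2 * k)
      + (q : ℂ) ^ n * X ^ (2 * n) := by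
  cases n with
  | zero => simp [polyS]
  | succ n => simp [polyS, aeval_polyR]

theorem RingEquiv.hasSum_idealZeta {A B : Type*} [CommRing A] [CommRing B] (e : A ≃+* B) {s z : ℂ}
    (h : HasSum (fun I : {I : Ideal A // Finite (A ⧸ I)} => 1 / (Nat.card (A ⧸ I.1) : ℂ) ^ s) z) :
    HasSum (fun I : {I : Ideal B // Finite (B ⧸ I)} => 1 / (Nat.card (B ⧸ I.1) : ℂ) ^ s) z := by
  have hq : ∀ I : Ideal A, Nonempty (A ⧸ I ≃ B ⧸ e.symm.idealComapOrderIso I) := fun I =>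
    ⟨(Ideal.quotientEquiv I _ e (Ideal.comap_symm e)).toEquiv⟩
  let E : {I : Ideal A // Finite (A ⧸ I)} ≃ {I : Ideal B // Finite (B ⧸ I)} :=
    e.symm.idealComapOrderIso.toEquiv.subtypeEquiv fun I => (hq I).some.finite_iff
  rw [← E.hasSum_iff]
  refine h.congr_fun fun I => ?_
  have : Nat.card (B ⧸ (E I).1) = Nat.card (A ⧸ I.1) := (Nat.card_congr (hq I.1).some).symm
  simp only [Function.comp, this]

/-! ### Root series: rescaling by `pⁿ` and the three cases at level `0` -/

namespace QuadraticAlgebra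

variable {R : Type*} [CommRing R] {a b p : R}

theorem HasRootSeries.mul_pow [IsDomain R] (hp : Prime p) [Finite (R ⧸ Ideal.span {p})]
    {X z : ℂ} (h : HasRootSeries a b p X z) (n : ℕ) :
    HasRootSeries (p ^ (2 * n) * a) (p ^ n * b) p X
      ((1 + X) * ∑ k ∈ Finset.range n, (Nat.card (R ⧸ Ideal.span {p}) : ℂ) ^ k * X ^ (2 * k)
        + (Nat.card (R ⧸ Ideal.span {p}) : ℂ) ^ n * X ^ (2 * n) * z) := by
  induction n with
  | zero => simpa using h
  | succ n ih =>
    have h1 := ih.mul_pow_two hp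
    rw [show p ^ 2 * (p ^ (2 * n) * a) = p ^ (2 * (n + 1)) * a by ring,
      show p * (p ^ n * b) = p ^ (n + 1) * b by ring] at h1
    convert h1 using 1
    rw [Finset.sum_range_succ', mul_add, mul_add, add_assoc]
    have : ∀ k ∈ Finset.range n, (Nat.card (R ⧸ Ideal.span {p}) : ℂ) ^ (k + 1) * X ^ (2 * (k + 1))
        = Nat.card (R ⧸ Ideal.span {p}) * X ^ 2 *
          ((Nat.card (R ⧸ Ideal.span {p}) : ℂ) ^ k * X ^ (2 * k)) := fun k _ => by ring
    rw [Finset.sum_congr rfl this, ← Finset.mul_sum]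
    ring

theorem hasRootSeries_of_ramified {X : ℂ} (h1 : Nat.card (RootsMod a b (p ^ 1)) = 1)
    (h2 : ∀ m : ℕ, Nat.card (RootsMod a b (p ^ (m + 2))) = 0) :
    HasRootSeries a b p X (1 + X) := by
  rw [HasRootSeries, ← hasSum_nat_add_iff' 2]
  simp only [Finset.sum_range_succ, Finset.sum_range_zero, card_rootsMod_pow_zero, h1, h2]
  simp

theorem hasRootSeries_of_unramified {X : ℂ}
    (h : ∀ m : ℕ, Nat.card (RootsMod a b (p ^ (m + 1))) = 0) :
    HasRootSeries a b p X 1 := by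
  rw [HasRootSeries, ← hasSum_nat_add_iff' 1]
  simp only [Finset.sum_range_one, card_rootsMod_pow_zero, h]
  simp

theorem hasRootSeries_of_split {X : ℂ} (hX : ‖X‖ < 1)
    (h : ∀ m : ℕ, Nat.card (RootsMod a b (p ^ (m + 1))) = 2) :
    HasRootSeries a b p X ((1 + X) * (1 - X)⁻¹) := by
  have hX1 : 1 - X ≠ 0 := sub_ne_zero.2 fun h => by simp [← h] at hX
  rw [HasRootSeries, ← hasSum_nat_add_iff' 1]
  simp only [Finset.sum_range_one, card_rootsMod_pow_zero, h]
  have h1 := (hasSum_geometric_of_norm_lt_one hX).mul_left (2 * X)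
  have h2 : (1 + X) * (1 - X)⁻¹ - ((1 : ℕ) : ℂ) * X ^ 0 = 2 * X * (1 - X)⁻¹ := by
    field_simp
    push_cast
    ring
  rw [h2]
  refine h1.congr_fun fun m => ?_
  push_cast
  ring

section Roots

theorem isUnit_omega_sub_iff {c : R} :
    IsUnit (ω - algebraMap R (QuadraticAlgebra R a b) c) ↔ IsUnit (c * c - (a + b * c)) := by
  rw [isUnit_iff_norm_isUnit, norm_def]
  simp only [re_sub, omega_re, algebraMap_re, im_sub, omega_im, algebraMap_im]
  rw [show (0 - c) * (0 - c) + b * (0 - c) * (1 - 0) - a * (1 - 0) * (1 - 0)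
    = c * c - (a + b * c) by ring]

theorem omega_sub_mul_omega_sub (c : R) :
    (ω - algebraMap R (QuadraticAlgebra R a b) c) * (ω - algebraMap R _ (b - c))
      = -algebraMap R _ (c * c - (a + b * c)) := by
  ext
  · simp
    ring
  · simp
    ring

variable [IsDomain R] [IsDiscreteValuationRing R]

/-- If `p` divides `f(c)` exactly once, then `p` is, up to a unit of `R`, the product `(ω - c)(ω -
(b - c))` of two nonunits. If `p²` divides `f(c)`, shifting `c` reduces to that case. -/
theorem not_dvd_of_irreducible_algebraMap (hp : Irreducible p)
    (hirr : Irreducible (algebraMap R (QuadraticAlgebra R a b) p))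
    (hnd : ∀ c, p ^ 2 ∣ c * c - (a + b * c) → ¬ p ∣ 2 * c - b) (c : R) :
    ¬ p ∣ c * c - (a + b * c) := by
  have hA : ∀ c u, c * c - (a + b * c) = p * u → ¬ IsUnit u := by
    intro c u hcu hu
    obtain ⟨v, hv⟩ := hu.exists_left_inv
    have hnu : ∀ d, d * d - (a + b * d) = p * u →
        ¬ IsUnit (ω - algebraMap R (QuadraticAlgebra R a b) d) := fun d hd h => by
      rw [isUnit_omega_sub_iff, hd] at h
      exact hp.not_isUnit (isUnit_of_mul_isUnit_left h)
    have hfac : algebraMap R (QuadraticAlgebra R a b) p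
        = (ω - algebraMap R _ c) * ((ω - algebraMap R _ (b - c)) * -algebraMap R _ v) := by
      rw [← mul_assoc, omega_sub_mul_omega_sub, hcu, neg_mul_neg, ← map_mul]
      congr 1
      linear_combination -p * hv
    rcases hirr.isUnit_or_isUnit hfac with h | h
    · exact hnu c hcu h
    · exact hnu (b - c) (by linear_combination hcu) (isUnit_of_mul_isUnit_left h)
  rintro ⟨u, hu⟩
  have hu' := hA c u hu
  rw [isUnit_iff_not_dvd_of_irreducible hp, not_not] at hu'
  obtain ⟨w, rfl⟩ := hu'
  have h2 := hnd c ⟨w, by linear_combination hu⟩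
  -- `f(c + p) = f(c) + p(2c - b) + p²`, and `p` does not divide `2c - b`.
  refine hA (c + p) (2 * c - b + p * (w + 1)) (by linear_combination hu) ?_
  rw [isUnit_iff_not_dvd_of_irreducible hp]
  exact fun h => h2 ((dvd_add_left (dvd_mul_right p _)).1 h)

/-- The `ω`-coordinate of `π` is a unit: otherwise `p` divides `π`, and norms give `p⁴ ∣ p²`. After
scaling, `p` divides `(ω - c)² = (a + c²) + (b - 2c)ω`, which makes `c` a double root modulo `p`. -/
theorem exists_double_root_of_associated (hp : Irreducible p) {π : QuadraticAlgebra R a b}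
    (hπ : Associated (algebraMap R (QuadraticAlgebra R a b) p) (π ^ 2)) :
    ∃ c, p ∣ c * c - (a + b * c) ∧ p ∣ 2 * c - b := by
  have hp' : Prime p := hp.prime
  have hdvd : ∀ w, p ∣ (w * π ^ 2).re ∧ p ∣ (w * π ^ 2).im := fun w =>
    algebraMap_dvd_iff.1 (hπ.dvd.mul_left w)
  have hv : IsUnit π.im := by
    rw [isUnit_iff_not_dvd_of_irreducible hp]
    intro hv
    have hu : p ∣ π.re := by
      have h1 := (hdvd 1).1
      rw [one_mul, sq, re_mul] at h1
      exact (hp'.dvd_or_dvd ((dvd_add_left (hv.mul_left _)).1 h1)).elim id id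
    obtain ⟨ρ, rfl⟩ := algebraMap_dvd_iff.2 ⟨hu, hv⟩
    have h2 := (hπ.map (norm : QuadraticAlgebra R a b →* R)).symm.dvd
    rw [map_pow, map_mul, norm_algebraMap, mul_pow] at h2
    have h3 : p ^ 2 * p ^ 2 ∣ p ^ 2 * 1 := by
      rw [mul_one]
      exact (Dvd.intro (norm ρ ^ 2) (by ring)).trans h2
    rw [mul_dvd_mul_iff_left (pow_ne_zero 2 hp.ne_zero)] at h3
    exact hp'.not_dvd_one ((dvd_pow_self p two_ne_zero).trans h3)
  obtain ⟨v, hv⟩ := hv.exists_left_inv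
  have h4 := hdvd (algebraMap R _ (v ^ 2))
  have h5 : algebraMap R _ (v ^ 2) * π ^ 2 = (ω - algebraMap R _ (-(v * π.re))) ^ 2 := by
    rw [map_pow, ← mul_pow]
    congr 1
    ext <;> simp [hv]
  set c := -(v * π.re)
  rw [h5, sq] at h4
  simp only [re_mul, im_mul, re_sub, im_sub, omega_re, omega_im, algebraMap_re, algebraMap_im] at h4
  obtain ⟨⟨r, hr⟩, ⟨t, ht⟩⟩ := h4
  exact ⟨c, ⟨-r - c * t, by linear_combination -hr - c * ht⟩, ⟨-t, by linear_combination -ht⟩⟩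

/-- Modulo `p` the polynomial is `(y - c)²`, so `c` is the only root; a root modulo `p²` would
reduce to this double root, against `hnd`. -/
theorem hasRootSeries_of_associated_sq (hp : Irreducible p) {π : QuadraticAlgebra R a b}
    (hπ : Associated (algebraMap R (QuadraticAlgebra R a b) p) (π ^ 2))
    (hnd : ∀ c, p ^ 2 ∣ c * c - (a + b * c) → ¬ p ∣ 2 * c - b) (X : ℂ) :
    HasRootSeries a b p X (1 + X) := by
  obtain ⟨c, hc, hc'⟩ := exists_double_root_of_associated hp hπ
  have huniq : ∀ y, p ∣ y * y - (a + b * y) → p ∣ y - c := by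
    intro y hy
    have h1 : p ∣ (y - c) * (y - c) := by
      have := (dvd_sub hy hc).sub (hc'.mul_left (y - c))
      rwa [show y * y - (a + b * y) - (c * c - (a + b * c)) - (y - c) * (2 * c - b)
        = (y - c) * (y - c) by ring] at this
    exact (hp.prime.dvd_or_dvd h1).elim id id
  refine hasRootSeries_of_ramified ?_ fun m => ?_
  · rw [pow_one]
    exact card_rootsMod_eq_one_of_forall hc huniq
  · refine card_rootsMod_eq_zero_of_forall fun y hy => ?_
    have h2 : p ^ 2 ∣ y * y - (a + b * y) := (pow_dvd_pow p (by omega)).trans hy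
    refine hnd y h2 ?_
    have h3 := huniq y ((dvd_pow_self p two_ne_zero).trans h2)
    have h4 := (h3.mul_left 2).add hc'
    rwa [show 2 * (y - c) + (2 * c - b) = 2 * y - b by ring] at h4

theorem hasRootSeries_of_irreducible_algebraMap (hp : Irreducible p)
    (hirr : Irreducible (algebraMap R (QuadraticAlgebra R a b) p))
    (hnd : ∀ c, p ^ 2 ∣ c * c - (a + b * c) → ¬ p ∣ 2 * c - b) (X : ℂ) :
    HasRootSeries a b p X 1 :=
  hasRootSeries_of_unramified fun m => card_rootsMod_eq_zero_of_forall fun y hy =>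
    not_dvd_of_irreducible_algebraMap hp hirr hnd y ((dvd_pow_self p (Nat.succ_ne_zero m)).trans hy)

/-- The polynomial is `(y - c)(y - d)`, and one factor is always a unit since `c - d` is. So there
are exactly two roots modulo each positive power of `p`. -/
theorem hasRootSeries_of_isUnit_sub (hp : Irreducible p) {c d : R} (hcd : IsUnit (c - d))
    (hc : c * c = a + b * c) (hd : d * d = a + b * d) {X : ℂ} (hX : ‖X‖ < 1) :
    HasRootSeries a b p X ((1 + X) * (1 - X)⁻¹) := by
  have hb : b = c + d := by
    refine hcd.mul_left_cancel ?_
    linear_combination hd - hc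
  have ha : a = -(c * d) := by linear_combination -hc - c * hb
  refine hasRootSeries_of_split hX fun m => card_rootsMod_eq_two_of_forall
    (by rw [hc, sub_self]; exact dvd_zero _) (by rw [hd, sub_self]; exact dvd_zero _)
    (fun h => hp.not_isUnit (isUnit_of_dvd_unit ((dvd_pow_self p (Nat.succ_ne_zero m)).trans h) hcd))
    fun y hy => ?_
  rw [show y * y - (a + b * y) = (y - c) * (y - d) by rw [ha, hb]; ring] at hy
  have hunit : IsUnit (y - c) ∨ IsUnit (y - d) := by
    rw [show c - d = -(y - c) + (y - d) by ring] at hcd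
    exact (IsLocalRing.isUnit_or_isUnit_of_isUnit_add hcd).imp_left (IsUnit.neg_iff _).1
  rcases hunit with h | h
  · exact Or.inr (h.dvd_mul_left.1 hy)
  · exact Or.inl (h.dvd_mul_right.1 hy)

end Roots

end QuadraticAlgebra

/-! ### The order generated by `Δ` as a quadratic algebra -/

section QuadraticOrder

variable {R K L : Type*} [CommRing R] [Field K]
  [Algebra R K] [IsFractionRing R K] [CommRing L] [Algebra K L] [Algebra R L] [IsScalarTower R K L]

theorem adjoin_fractionField_eq_top_of_adjoin_eq_integralClosure [IsDomain R]
    [Algebra.IsAlgebraic K L] {Δ : L}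
    (hΔ : Algebra.adjoin R {Δ} = integralClosure R L) : Algebra.adjoin K {Δ} = ⊤ := by
  refine eq_top_iff.2 fun l _ => ?_
  obtain ⟨⟨r, hr⟩, hl⟩ := IsIntegral.exists_multiple_integral_of_isLocalization R⁰ l
    (Algebra.IsIntegral.isIntegral (R := K) l)
  rw [Submonoid.mk_smul] at hl
  have hle : Algebra.adjoin R {Δ} ≤ (Algebra.adjoin K {Δ}).restrictScalars R :=
    Algebra.adjoin_le Algebra.subset_adjoin
  rw [hΔ] at hle
  have h2 : r • l ∈ Algebra.adjoin K {Δ} := hle hl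
  have hr' : algebraMap R K r ≠ 0 := by
    rw [Ne, FaithfulSMul.algebraMap_eq_zero_iff]
    exact nonZeroDivisors.ne_zero hr
  rw [← algebraMap_smul K r l] at h2
  have h3 := (Algebra.adjoin K {Δ}).smul_mem h2 (algebraMap R K r)⁻¹
  rw [smul_smul, inv_mul_cancel₀ hr', one_smul] at h3
  exact h3

theorem natDegree_minpoly_eq_two_of_adjoin_eq_top (hL : Module.finrank K L = 2) {Δ : L}
    (hΔ : Algebra.adjoin K {Δ} = ⊤) : (minpoly K Δ).natDegree = 2 := by
  have : Module.Finite K L := Module.finite_of_finrank_pos (by omega)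
  have hint : IsIntegral K Δ := Algebra.IsIntegral.isIntegral Δ
  rw [← Algebra.adjoin.powerBasis_dim hint, ← (Algebra.adjoin.powerBasis hint).finrank, hΔ, ← hL]
  exact (Subalgebra.topEquiv (R := K) (A := L)).toLinearEquiv.finrank_eq

theorem eq_zero_of_algebraMap_add_smul_eq_zero {Δ : L} (hdeg : (minpoly K Δ).natDegree = 2)
    {x y : K} (h : algebraMap K L x + y • Δ = 0) : x = 0 ∧ y = 0 := by
  by_contra hne
  have hf : (C y * X + C x : K[X]) ≠ 0 := fun h0 => hne
    ⟨by simpa using congrArg (coeff · 0) h0, by simpa using congrArg (coeff · 1) h0⟩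
  have h1 := natDegree_le_natDegree (minpoly.degree_le_of_ne_zero K Δ hf <| by
    simpa [Algebra.smul_def, add_comm] using h)
  have h2 : (C y * X + C x : K[X]).natDegree ≤ 1 := natDegree_linear_le
  omega

/-- Over an integrally closed ring, a monic factor over `K` of a monic polynomial over `R` has
coefficients in `R`. -/
theorem exists_mul_self_eq_of_isIntegral [IsDomain R] [IsIntegrallyClosed R] {Δ : L}
    (hdeg : (minpoly K Δ).natDegree = 2)
    (hint : IsIntegral R Δ) : ∃ a b : R, Δ * Δ = a • (1 : L) + b • Δ := by
  obtain ⟨g, hg, hgΔ⟩ := hint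
  have hmonic : (minpoly K Δ).Monic := minpoly.monic (IsIntegral.tower_top ⟨g, hg, hgΔ⟩)
  have hdvd : minpoly K Δ ∣ g.map (algebraMap R K) := minpoly.dvd K Δ (by
    rw [aeval_map_algebraMap]
    exact hgΔ)
  obtain ⟨f, hf⟩ := IsIntegrallyClosed.eq_map_mul_C_of_dvd K hg hdvd
  rw [hmonic.leadingCoeff, C_1, mul_one] at hf
  have hfd : f.natDegree = 2 := by
    rw [← hdeg, ← hf, natDegree_map_eq_of_injective (IsFractionRing.injective R K)]
  have hf2 : f.coeff 2 = 1 := by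
    apply IsFractionRing.injective R K
    rw [← coeff_map, hf, map_one, ← hdeg]
    exact hmonic
  have hroot : aeval Δ f = 0 := by
    rw [← aeval_map_algebraMap K, hf, minpoly.aeval]
  rw [aeval_eq_sum_range, hfd] at hroot
  simp only [Finset.sum_range_succ, Finset.sum_range_zero, hf2, pow_zero, pow_one, zero_add,
    one_smul] at hroot
  refine ⟨-f.coeff 0, -f.coeff 1, ?_⟩
  rw [neg_smul, neg_smul, ← sq]
  linear_combination hroot

namespace QuadraticAlgebra

variable {a b : R}

/-- The homomorphism from a quadratic algebra sending `ω` to `Δ`. -/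
abbrev ofRoot {Δ : L} (h : Δ * Δ = a • (1 : L) + b • Δ) : QuadraticAlgebra R a b →ₐ[R] L :=
  lift ⟨Δ, h⟩

theorem range_ofRoot {Δ : L} (h : Δ * Δ = a • (1 : L) + b • Δ) :
    (ofRoot h).range = Algebra.adjoin R {Δ} := by
  refine le_antisymm ?_ (Algebra.adjoin_le (Set.singleton_subset_iff.2 ⟨ω, ?_⟩))
  · rintro _ ⟨z, rfl⟩
    have hΔ : Δ ∈ Algebra.adjoin R {Δ} := Algebra.self_mem_adjoin_singleton R Δ
    exact add_mem (Subalgebra.smul_mem _ (one_mem _) _) (Subalgebra.smul_mem _ hΔ _)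
  · change ofRoot h ω = Δ
    simp

theorem ofRoot_injective (K : Type*) [Field K] [Algebra R K] [IsFractionRing R K] [Algebra K L]
    [IsScalarTower R K L] {Δ : L} (h : Δ * Δ = a • (1 : L) + b • Δ)
    (hΔ : ∀ x y : K, algebraMap K L x + y • Δ = 0 → x = 0 ∧ y = 0) :
    Function.Injective (ofRoot h) := by
  refine (injective_iff_map_eq_zero _).2 fun z hz => ?_
  have h1 := hΔ (algebraMap R K z.re) (algebraMap R K z.im) (by
    rw [← IsScalarTower.algebraMap_apply, algebraMap_smul, Algebra.algebraMap_eq_smul_one]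
    exact hz)
  simp only [FaithfulSMul.algebraMap_eq_zero_iff] at h1
  exact QuadraticAlgebra.ext h1.1 h1.2

/-- A quadratic algebra is isomorphic to the subalgebra generated by a root. -/
noncomputable def equivAdjoin {Δ : L} (h : Δ * Δ = a • (1 : L) + b • Δ)
    (hinj : Function.Injective (ofRoot h)) : QuadraticAlgebra R a b ≃ₐ[R] Algebra.adjoin R {Δ} :=
  (AlgEquiv.ofInjective _ hinj).trans (Subalgebra.equivOfEq _ _ (range_ofRoot h))

/-- This is where maximality enters. Otherwise `y = (Δ - c)/p` satisfies `y² + ty + r = 0` with `t =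
f'(c)/p` and `r = f(c)/p²`, so `y` is integral and lies in `R[Δ]`, although its `Δ`-coordinate is
`1/p`. -/
theorem not_dvd_of_sq_dvd [IsDomain R] {Δ : L} (h : Δ * Δ = a • (1 : L) + b • Δ)
    (hinj : Function.Injective (ofRoot h)) (hΔ : Algebra.adjoin R {Δ} = integralClosure R L)
    (K : Type*) [Field K] [Algebra R K] [IsFractionRing R K] [Algebra K L]
    [IsScalarTower R K L] {p : R} (hp : Irreducible p) (c : R)
    (h1 : p ^ 2 ∣ c * c - (a + b * c)) : ¬ p ∣ 2 * c - b := by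
  rintro ⟨t, ht⟩
  obtain ⟨r, hr⟩ := h1
  have hp' : algebraMap R K p ≠ 0 := by simpa using hp.ne_zero
  set y : L := (algebraMap R K p)⁻¹ • (Δ - algebraMap R L c) with hy
  have hpy : algebraMap R L p * y = Δ - algebraMap R L c := by
    rw [hy, mul_smul_comm, IsScalarTower.algebraMap_apply R K L, ← Algebra.smul_def, smul_smul,
      inv_mul_cancel₀ hp', one_smul]
  have hunit : IsUnit (algebraMap R L p) := by
    rw [IsScalarTower.algebraMap_apply R K L]
    exact (IsUnit.mk0 _ hp').map _
  have hyy : y ^ 2 + algebraMap R L t * y + algebraMap R L r = 0 := by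
    refine (hunit.pow 2).mul_left_cancel ?_
    have h2 := congrArg (algebraMap R L) ht
    have h3 := congrArg (algebraMap R L) hr
    simp only [Algebra.smul_def, mul_one] at h
    simp only [map_sub, map_mul, map_add, map_pow, map_ofNat] at h2 h3
    linear_combination (algebraMap R L p * y + (Δ - algebraMap R L c) + algebraMap R L p *
      algebraMap R L t) * hpy + h - h3 - (Δ - algebraMap R L c) * h2
  have hint : IsIntegral R y := by
    refine ⟨X ^ 2 + C t * X + C r, ?_, ?_⟩
    · monicity!
    · simpa using hyy
  have hmem : y ∈ (ofRoot h).range := by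
    rw [range_ofRoot, hΔ]
    exact hint
  obtain ⟨z, hz⟩ := hmem
  have h5 : algebraMap R _ p * z = ω - algebraMap R _ c := by
    apply hinj
    rw [map_mul, AlgHom.commutes, map_sub, AlgHom.commutes]
    change algebraMap R L p * (ofRoot h).toRingHom z = _
    rw [hz, hpy]
    simp
  have h6 := congrArg im h5
  simp at h6
  exact hp.not_dvd_one ⟨_, h6.symm⟩

end QuadraticAlgebra

/-- The roots `c, d` are the two components of `Δ`. The idempotent `(1, 0)` is integral, hence
equals `u + vΔ` with `u, v ∈ R`; subtracting components gives `v(c - d) = 1`. -/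
theorem exists_roots_of_algEquiv_prod [IsDomain R] [IsIntegrallyClosed R] {a b : R} {Δ : L}
    (h : Δ * Δ = a • (1 : L) + b • Δ)
    (hΔ : Algebra.adjoin R {Δ} = integralClosure R L) (e : L ≃ₐ[K] K × K) :
    ∃ c d : R, IsUnit (c - d) ∧ c * c = a + b * c ∧ d * d = a + b * d := by
  have hΔint : IsIntegral R Δ := by
    have h1 : Δ ∈ Algebra.adjoin R {Δ} := Algebra.self_mem_adjoin_singleton R Δ
    rw [hΔ] at h1
    exact h1
  have key : ∀ f : L →ₐ[K] K, ∃ c : R, algebraMap R K c = f Δ ∧ c * c = a + b * c := by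
    intro f
    obtain ⟨c, hc⟩ := IsIntegrallyClosed.isIntegral_iff.1 (hΔint.map (f.restrictScalars R))
    refine ⟨c, hc, IsFractionRing.injective R K ?_⟩
    have h2 := congrArg (f.restrictScalars R) h
    rw [map_mul, map_add, map_smul, map_smul, map_one, ← hc] at h2
    simpa [Algebra.smul_def] using h2
  obtain ⟨c, hc, hc'⟩ := key ((AlgHom.fst K K K).comp e.toAlgHom)
  obtain ⟨d, hd, hd'⟩ := key ((AlgHom.snd K K K).comp e.toAlgHom)
  have hε : IsIntegral R (e.symm (1, 0)) := by
    refine ⟨X ^ 2 + C (-1) * X + C 0, by monicity!, ?_⟩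
    have : e.symm (1, 0) ^ 2 = e.symm (1, 0) := by
      rw [← map_pow]
      simp
    simp [this]
  have hmem : e.symm (1, 0) ∈ (QuadraticAlgebra.ofRoot h).range := by
    rw [QuadraticAlgebra.range_ofRoot, hΔ]
    exact hε
  obtain ⟨z, hz⟩ := hmem
  have hz' : algebraMap K L (algebraMap R K z.re) + algebraMap K L (algebraMap R K z.im) * Δ
      = e.symm (1, 0) := by
    rw [← hz, ← IsScalarTower.algebraMap_apply, ← IsScalarTower.algebraMap_apply,
      ← Algebra.smul_def, Algebra.algebraMap_eq_smul_one]
    rfl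
  have h3 := congrArg (fun l => (e l).1) hz'
  have h4 := congrArg (fun l => (e l).2) hz'
  replace hc : algebraMap R K c = (e Δ).1 := hc
  replace hd : algebraMap R K d = (e Δ).2 := hd
  simp [← hc] at h3
  simp [← hd] at h4
  refine ⟨c, d, IsUnit.of_mul_eq_one z.im (IsFractionRing.injective R K ?_), hc', hd'⟩
  rw [map_mul, map_sub, map_one]
  linear_combination h3 - h4

end QuadraticOrder

/-! ### Zeta functions of the orders and the three cases -/

section QuadraticOrder

variable {R L : Type*} [CommRing R] [CommRing L] [Algebra R L] {a b p : R} {Δ : L}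

open QuadraticAlgebra

theorem hasSum_idealZeta_adjoin_pow_smul [IsDomain R] [IsDiscreteValuationRing R]
    (K : Type*) [Field K] [Algebra R K] [IsFractionRing R K]
    [Algebra K L] [IsScalarTower R K L] (hp : Irreducible p) [Finite (R ⧸ Ideal.span {p})]
    (h : Δ * Δ = a • (1 : L) + b • Δ)
    (hΔ : ∀ x y : K, algebraMap K L x + y • Δ = 0 → x = 0 ∧ y = 0)
    {s z : ℂ} (hX : ‖(Nat.card (R ⧸ Ideal.span {p}) : ℂ) ^ (-s)‖ < 1)
    (hz : HasRootSeries a b p ((Nat.card (R ⧸ Ideal.span {p}) : ℂ) ^ (-s)) z) (n : ℕ) :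
    HasSum (fun I : {I : Ideal (Algebra.adjoin R {p ^ n • Δ}) //
        Finite (Algebra.adjoin R {p ^ n • Δ} ⧸ I)} =>
        1 / (Nat.card (Algebra.adjoin R {p ^ n • Δ} ⧸ I.1) : ℂ) ^ s)
      ((1 - ((Nat.card (R ⧸ Ideal.span {p}) : ℂ) ^ (-s)) ^ 2)⁻¹ *
        ((1 + (Nat.card (R ⧸ Ideal.span {p}) : ℂ) ^ (-s)) *
          ∑ k ∈ Finset.range n, (Nat.card (R ⧸ Ideal.span {p}) : ℂ) ^ k *
            ((Nat.card (R ⧸ Ideal.span {p}) : ℂ) ^ (-s)) ^ (2 * k)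
          + (Nat.card (R ⧸ Ideal.span {p}) : ℂ) ^ n *
            ((Nat.card (R ⧸ Ideal.span {p}) : ℂ) ^ (-s)) ^ (2 * n) * z)) := by
  have hn : (p ^ n • Δ) * (p ^ n • Δ)
      = (p ^ (2 * n) * a) • (1 : L) + (p ^ n * b) • (p ^ n • Δ) := by
    simp only [Algebra.smul_def, mul_one, map_mul, map_pow] at h ⊢
    linear_combination (algebraMap R L p) ^ (2 * n) * h
  have hinj : Function.Injective (ofRoot hn) := by
    refine ofRoot_injective K hn fun x y hxy => ?_
    have hpn : algebraMap R K (p ^ n) ≠ 0 := by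
      rw [Ne, FaithfulSMul.algebraMap_eq_zero_iff]
      exact pow_ne_zero n hp.ne_zero
    rw [← algebraMap_smul K (p ^ n) Δ, smul_smul] at hxy
    exact (hΔ _ _ hxy).imp_right fun h => (mul_eq_zero.1 h).resolve_right hpn
  exact (equivAdjoin hn hinj).toRingEquiv.hasSum_idealZeta
    (QuadraticAlgebra.hasSum_idealZeta hp hX (hz.mul_pow hp.prime n))

theorem exists_irreducible_associated_pow_of_map_eq (h : Δ * Δ = a • (1 : L) + b • Δ)
    (hinj : Function.Injective (ofRoot h)) (hΔ : Algebra.adjoin R {Δ} = integralClosure R L)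
    (hL : IsField L) {e : ℕ} {π : integralClosure R L} (hirr : Irreducible π)
    (hπ : Ideal.map (algebraMap R (integralClosure R L)) (Ideal.span {p}) = Ideal.span {π} ^ e) :
    ∃ ρ : QuadraticAlgebra R a b, Irreducible ρ ∧ Associated (algebraMap R _ p) (ρ ^ e) := by
  have : IsDomain L := hL.isDomain
  let E : QuadraticAlgebra R a b ≃ₐ[R] integralClosure R L :=
    (equivAdjoin h hinj).trans (Subalgebra.equivOfEq _ _ hΔ)
  rw [Ideal.map_span, Set.image_singleton, Ideal.span_singleton_pow,
    Ideal.span_singleton_eq_span_singleton] at hπ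
  refine ⟨E.symm π, (MulEquiv.irreducible_iff E.symm).2 hirr, ?_⟩
  have := hπ.map E.symm
  rwa [map_pow, AlgEquiv.commutes] at this

end QuadraticOrder

theorem Complex.norm_natCast_cpow_neg_lt_one {q : ℕ} (hq : 1 < q) {s : ℂ} (hs : 0 < s.re) :
    ‖(q : ℂ) ^ (-s)‖ < 1 := by
  rw [Complex.norm_natCast_cpow_of_pos (by omega), Complex.neg_re]
  exact Real.rpow_lt_one_of_one_lt_of_neg (by exact_mod_cast hq) (by linarith)

theorem theorem5p4
    {K : Type*} [Field K] [ValuativeRel K] [TopologicalSpace K] [IsNonarchimedeanLocalField K]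
    [CharZero K]
    {L : Type*} [CommRing L] [IsReduced L] [Algebra K L] (hL : Module.finrank K L = 2)
    (ϖ : 𝒪[K]) (hϖ : Irreducible ϖ)
    (Δ : L) (hΔ : Algebra.adjoin 𝒪[K] {Δ} = ringOfIntegers K L)
    (q : ℕ) (hq : q = Nat.card 𝓀[K]) :
    (∀ n : ℕ,
      polyU q n = ∑ k ∈ Finset.range n,
          ((q : ℤ[X]) ^ k * X ^ (2 * k) + (q : ℤ[X]) ^ k * X ^ (2 * k + 1))
        + (q : ℤ[X]) ^ n * X ^ (2 * n) ∧
      polyS q n = ∑ k ∈ Finset.range n,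
          ((q : ℤ[X]) ^ k * X ^ (2 * k) - (q : ℤ[X]) ^ k * X ^ (2 * k + 1))
        + (q : ℤ[X]) ^ n * X ^ (2 * n)) ∧
    (IsRamifiedCase K L → ∀ (n : ℕ) (s : ℂ), 0 < s.re →
      IdealZetaConverges (mainOrder K ϖ Δ n) s ∧
      (1 - (q : ℂ) ^ (-s)) * idealZeta (mainOrder K ϖ Δ n) s
        = aeval ((q : ℂ) ^ (-s)) (polyR q n)) ∧
    (IsUnramifiedCase K L → ∀ (n : ℕ) (s : ℂ), 0 < s.re →
      IdealZetaConverges (mainOrder K ϖ Δ n) s ∧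
      (1 - (q : ℂ) ^ (-2 * s)) * idealZeta (mainOrder K ϖ Δ n) s
        = aeval ((q : ℂ) ^ (-s)) (polyU q n)) ∧
    (IsSplitCase K L → ∀ (n : ℕ) (s : ℂ), 0 < s.re →
      IdealZetaConverges (mainOrder K ϖ Δ n) s ∧
      (1 - (q : ℂ) ^ (-s)) ^ 2 * idealZeta (mainOrder K ϖ Δ n) s
        = aeval ((q : ℂ) ^ (-s)) (polyS q n)) := by
  have hmax : 𝓂[K] = Ideal.span {ϖ} := hϖ.maximalIdeal_eq
  have hcard : Nat.card (𝒪[K] ⧸ Ideal.span {ϖ}) = q := by rw [hq, ← hmax]; rfl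
  have hfin : Finite (𝒪[K] ⧸ Ideal.span {ϖ}) := by
    rw [← hmax]
    exact inferInstanceAs (Finite 𝓀[K])
  have hq1 : 1 < q := by
    rw [hq]
    exact Finite.one_lt_card
  have : Module.Finite K L := Module.finite_of_finrank_pos (by omega)
  have hdeg : (minpoly K Δ).natDegree = 2 := natDegree_minpoly_eq_two_of_adjoin_eq_top hL
    (adjoin_fractionField_eq_top_of_adjoin_eq_integralClosure hΔ)
  have hlin := fun x y : K => eq_zero_of_algebraMap_add_smul_eq_zero (x := x) (y := y) hdeg
  have hint : IsIntegral 𝒪[K] Δ := by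
    have h1 : Δ ∈ Algebra.adjoin 𝒪[K] {Δ} := Algebra.self_mem_adjoin_singleton _ Δ
    rw [hΔ] at h1
    exact h1
  obtain ⟨a, b, hab⟩ := exists_mul_self_eq_of_isIntegral hdeg hint
  have hinj := QuadraticAlgebra.ofRoot_injective K hab hlin
  have hnd := QuadraticAlgebra.not_dvd_of_sq_dvd hab hinj hΔ K hϖ
  -- The denominator `1 - X²` is kept factored as `(1 - X)(1 + X)`, since the ramified and split
  -- cases cancel `1 + X`.
  have hzeta : ∀ (n : ℕ) (s : ℂ), 0 < s.re → ∀ z : ℂ,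
      QuadraticAlgebra.HasRootSeries a b ϖ ((q : ℂ) ^ (-s)) z →
      IdealZetaConverges (mainOrder K ϖ Δ n) s ∧
      (1 - (q : ℂ) ^ (-s)) * (1 + (q : ℂ) ^ (-s)) * idealZeta (mainOrder K ϖ Δ n) s
        = (1 + (q : ℂ) ^ (-s)) *
          ∑ k ∈ Finset.range n, (q : ℂ) ^ k * ((q : ℂ) ^ (-s)) ^ (2 * k)
          + (q : ℂ) ^ n * ((q : ℂ) ^ (-s)) ^ (2 * n) * z := by
    intro n s hs z hz
    have hX := Complex.norm_natCast_cpow_neg_lt_one hq1 hs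
    have hsum := hasSum_idealZeta_adjoin_pow_smul K hϖ hab hlin (hcard.symm ▸ hX)
      (hcard.symm ▸ hz) n
    rw [hcard] at hsum
    refine ⟨hsum.summable, ?_⟩
    have hne : 1 - ((q : ℂ) ^ (-s)) ^ 2 ≠ 0 := sub_ne_zero.2 fun h => by
      have h1 := pow_lt_one₀ (norm_nonneg _) hX two_ne_zero
      rw [← norm_pow, ← h, norm_one] at h1
      exact lt_irrefl _ h1
    rw [idealZeta, hsum.tsum_eq, show (1 - (q : ℂ) ^ (-s)) * (1 + (q : ℂ) ^ (-s))
      = 1 - ((q : ℂ) ^ (-s)) ^ 2 by ring, mul_inv_cancel_left₀ hne]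
  have hadd : ∀ s : ℂ, 0 < s.re → 1 + (q : ℂ) ^ (-s) ≠ 0 := fun s hs h => by
    have hX := Complex.norm_natCast_cpow_neg_lt_one hq1 hs
    rw [eq_neg_of_add_eq_zero_right h, norm_neg, norm_one] at hX
    exact lt_irrefl _ hX
  refine ⟨fun n => ⟨polyU_eq_sum q n, polyS_eq_sum q n⟩, ?_, ?_, ?_⟩
  · rintro ⟨hfield, π, hπ, hmap⟩ n s hs
    rw [hmax] at hmap
    obtain ⟨ρ, -, hρ⟩ := exists_irreducible_associated_pow_of_map_eq hab hinj hΔ hfield hπ hmap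
    obtain ⟨h1, h2⟩ := hzeta n s hs _
      (QuadraticAlgebra.hasRootSeries_of_associated_sq hϖ hρ hnd _)
    refine ⟨h1, mul_left_cancel₀ (hadd s hs) ?_⟩
    rw [aeval_polyR, Finset.sum_range_succ]
    linear_combination h2
  · rintro ⟨hfield, π, hπ, hmap⟩ n s hs
    rw [hmax] at hmap
    obtain ⟨ρ, hirr, hρ⟩ := exists_irreducible_associated_pow_of_map_eq hab hinj hΔ hfield hπ hmap
    rw [pow_one] at hρ
    obtain ⟨h1, h2⟩ := hzeta n s hs _
      (QuadraticAlgebra.hasRootSeries_of_irreducible_algebraMap hϖ (hρ.irreducible_iff.2 hirr)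
        hnd _)
    refine ⟨h1, ?_⟩
    have h3 : (q : ℂ) ^ (-2 * s) = ((q : ℂ) ^ (-s)) ^ 2 := by
      rw [← Complex.cpow_nat_mul]
      congr 1
      push_cast
      ring
    rw [aeval_polyU, h3]
    linear_combination h2
  · rintro ⟨e⟩ n s hs
    obtain ⟨c, d, hcd, hc, hd⟩ := exists_roots_of_algEquiv_prod hab hΔ e
    have hX := Complex.norm_natCast_cpow_neg_lt_one hq1 hs
    have hsub : 1 - (q : ℂ) ^ (-s) ≠ 0 := sub_ne_zero.2 fun h => by
      rw [← h, norm_one] at hX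
      exact lt_irrefl _ hX
    obtain ⟨h1, h2⟩ := hzeta n s hs _
      (QuadraticAlgebra.hasRootSeries_of_isUnit_sub hϖ hcd hc hd hX)
    refine ⟨h1, mul_left_cancel₀ (hadd s hs) ?_⟩
    rw [aeval_polyS]
    -- The extra factor `1 - X` clears the denominator of the split root series `(1 + X)/(1 - X)`.
    linear_combination (1 - (q : ℂ) ^ (-s)) * h2 + (q : ℂ) ^ n * ((q : ℂ) ^ (-s)) ^ (2 * n) *
      (1 + (q : ℂ) ^ (-s)) * mul_inv_cancel₀ hsub
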